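/- Let $[a,b]\subset\mathbb{R}$ be a compact interval with $a<b$, let $m\ge 1$, $r\ge 2$, $n\ge 0$ be integers, and let $0<\alpha\le 1$. For an integer $k\ge 0$, let $C^{k,\alpha}$ be the space of all $k$ times continuously differentiable functions $x:[a,b]\to\mathbb{C}$ with finite norm $$\|x\|_{k,\alpha}=\sum_{j=0}^{k}\max_{a\le t\le b}|x^{(j)}(t)|+\sup_{a\le t_1<t_2\le b}\frac{|x^{(k)}(t_2)-x^{(k)}(t_1)|}{|t_2-t_1|^{\alpha}} .$$ Let $(C^{k,\alpha})^{m}$ and $(C^{k,\alpha})^{m\times m}$ be the spaces of vector- and matrix-valued functions with entries in $C^{k,\alpha}$, whose norms, also denoted by $\|\cdot\|_{k,\alpha}$, are the sums of the norms of the entries. Let $|\cdot|$ be the Euclidean norm on $\mathbb{C}^{rm}$. Let $\varepsilon_0>0$. For every $\varepsilon\in[0,\varepsilon_0)$ let $A_0(\cdot,\varepsilon),\dots,A_{r-1}(\cdot,\varepsilon)\in(C^{n,\alpha})^{m\times m}$, let $B(\varepsilon):(C^{n+r,\alpha})^{m}\to\mathbb{C}^{rm}$ be a continuous linear operator, and put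 $$L(\varepsilon)y=y^{(r)}+\sum_{j=1}^{r}A_{r-j}(\cdot,\varepsilon)\,y^{(r-j)},\qquad y\in(C^{n+r,\alpha})^{m}.$$ Assume: * Condition (0): if $y\in(C^{n+r,\alpha})^{m}$, $L(0)y=0$ and $B(0)y=0$, then $y=0$; * Limit Condition (I): $A_{r-j}(\cdot,\varepsilon)\to A_{r-j}(\cdot,0)$ in $(C^{n,\alpha})^{m\times m}$ as $\varepsilon\to0+$ for each $j\in\{1,\dots,r\}$; * Limit Condition (II): $B(\varepsilon)y\to B(0)y$ in $\mathbb{C}^{rm}$ as $\varepsilon\to0+$ for every $y\in(C^{n+r,\alpha})^{m}$. Then there is a number $\varepsilon_1\in(0,\varepsilon_0)$ such that ($\ast$) for every $\varepsilon\in[0,\varepsilon_1)$, every $f\in(C^{n,\alpha})^{m}$ and every $c\in\mathbb{C}^{rm}$ the problem $L(\varepsilon)y=f$, $B(\varepsilon)y=c$ has a unique solution $y\in(C^{n+r,\alpha})^{m}$. Moreover, for every $\varepsilon_1\in(0,\varepsilon_0)$ with property ($\ast$) there are positive numbers $\varepsilon_2<\varepsilon_1$, $\varkappa_1$ and $\varkappa_2$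 such that, for all right-hand sides $f(\cdot,\varepsilon)\in(C^{n,\alpha})^{m}$ and $c(\varepsilon)\in\mathbb{C}^{rm}$, $\varepsilon\in[0,\varepsilon_1)$, the solutions $y(\cdot,\varepsilon)\in(C^{n+r,\alpha})^{m}$ of the problems $L(\varepsilon)y(\cdot,\varepsilon)=f(\cdot,\varepsilon)$, $B(\varepsilon)y(\cdot,\varepsilon)=c(\varepsilon)$ satisfy $$\varkappa_1\,d_{n,\alpha}(\varepsilon)\le\|y(\cdot,0)-y(\cdot,\varepsilon)\|_{n+r,\alpha}\le\varkappa_2\,d_{n,\alpha}(\varepsilon)\qquad\text{for every }\varepsilon\in(0,\varepsilon_2),$$ where $$d_{n,\alpha}(\varepsilon)=\|L(\varepsilon)y(\cdot,0)-f(\cdot,\varepsilon)\|_{n,\alpha}+|B(\varepsilon)y(\cdot,0)-c(\varepsilon)| .$$ The numbers $\varepsilon_2,\varkappa_1,\varkappa_2$ depend neither on the right-hand sides nor on the solutions. -/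

import Mathlib

open Set Filter Topology

/-- The `j`-th derivative on `[a, b]` (one-sided at the end points) of a function
`x : [a, b] → ℂ`. -/
noncomputable def iccDeriv {a b : ℝ} (hab : a < b) (j : ℕ) (x : Icc a b → ℂ) : Icc a b → ℂ :=
  fun t => iteratedDerivWithin j (IccExtend hab.le x) (Icc a b) (t : ℝ)

/-- The Hölder quotients `|x(t₂) - x(t₁)| / |t₂ - t₁| ^ α`, indexed by the pairs `t₁ < t₂`. -/
noncomputable def holderQuot {a b : ℝ} (α : ℝ) (x : Icc a b → ℂ)
    (p : {p : Icc a b × Icc a b // p.1 < p.2}) : ℝ :=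
  ‖x p.1.2 - x p.1.1‖ / |(p.1.2 : ℝ) - (p.1.1 : ℝ)| ^ α

/-- Membership in the Hölder space `C^{n,α}([a, b], ℂ)`. -/
structure IsHolder {a b : ℝ} (hab : a < b) (n : ℕ) (α : ℝ) (x : Icc a b → ℂ) : Prop where
  contDiffOn : ContDiffOn ℝ n (IccExtend hab.le x) (Icc a b)
  bddAbove : BddAbove (range (holderQuot α (iccDeriv hab n x)))

section HolderFacts

variable {a b : ℝ} {hab : a < b} {n : ℕ} {α : ℝ} {x y : Icc a b → ℂ}

theorem iccExtend_coe (t : Icc a b) : IccExtend hab.le x (t : ℝ) = x t :=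
  IccExtend_val hab.le x t

theorem iccDeriv_zero : iccDeriv hab 0 x = x := by
  funext t
  simp [iccDeriv]

theorem iccExtend_iccDeriv_eqOn (j : ℕ) :
    EqOn (IccExtend hab.le (iccDeriv hab j x))
      (iteratedDerivWithin j (IccExtend hab.le x) (Icc a b)) (Icc a b) := by
  intro t ht
  rw [IccExtend_of_mem hab.le _ ht]
  rfl

theorem iccExtend_iccDeriv_one_eqOn :
    EqOn (IccExtend hab.le (iccDeriv hab 1 x))
      (derivWithin (IccExtend hab.le x) (Icc a b)) (Icc a b) := by
  intro t ht
  rw [iccExtend_iccDeriv_eqOn 1 ht, iteratedDerivWithin_one]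

theorem iccDeriv_succ (j : ℕ) : iccDeriv hab (j + 1) x = iccDeriv hab j (iccDeriv hab 1 x) := by
  funext t
  unfold iccDeriv
  rw [iteratedDerivWithin_succ']
  exact (iteratedDerivWithin_congr (iccExtend_iccDeriv_one_eqOn (hab := hab)) t.2).symm

theorem iccDeriv_add (hx : ContDiffOn ℝ n (IccExtend hab.le x) (Icc a b))
    (hy : ContDiffOn ℝ n (IccExtend hab.le y) (Icc a b)) {j : ℕ} (hj : j ≤ n) :
    iccDeriv hab j (x + y) = iccDeriv hab j x + iccDeriv hab j y := by
  funext t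
  have hj' : (j : WithTop ℕ∞) ≤ n := by exact_mod_cast hj
  exact iteratedDerivWithin_add t.2 (uniqueDiffOn_Icc hab)
    ((hx.of_le hj') t t.2) ((hy.of_le hj') t t.2)

theorem iccDeriv_smul (c : ℂ) (j : ℕ) :
    iccDeriv hab j (c • x) = c • iccDeriv hab j x := by
  funext t
  exact iteratedDerivWithin_const_smul_field c (IccExtend hab.le x)

theorem holderQuot_nonneg (p) : 0 ≤ holderQuot α x p := by
  unfold holderQuot
  positivity

theorem holderQuot_add_le (p) : holderQuot α (x + y) p ≤ holderQuot α x p + holderQuot α y p := by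
  unfold holderQuot
  rw [← add_div]
  gcongr
  simp only [Pi.add_apply]
  rw [add_sub_add_comm]
  exact norm_add_le _ _

theorem holderQuot_smul (c : ℂ) (p) : holderQuot α (c • x) p = ‖c‖ * holderQuot α x p := by
  unfold holderQuot
  simp only [Pi.smul_apply]
  rw [← smul_sub, norm_smul, mul_div_assoc]

theorem IsHolder.add (hx : IsHolder hab n α x) (hy : IsHolder hab n α y) :
    IsHolder hab n α (x + y) := by
  refine ⟨hx.1.add hy.1, ?_⟩
  obtain ⟨C, hC⟩ := hx.2
  obtain ⟨D, hD⟩ := hy.2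
  refine ⟨C + D, ?_⟩
  rintro _ ⟨p, rfl⟩
  rw [iccDeriv_add hx.1 hy.1 le_rfl]
  exact (holderQuot_add_le p).trans (add_le_add (hC ⟨p, rfl⟩) (hD ⟨p, rfl⟩))

theorem IsHolder.smul (c : ℂ) (hx : IsHolder hab n α x) : IsHolder hab n α (c • x) := by
  refine ⟨hx.1.const_smul c, ?_⟩
  obtain ⟨C, hC⟩ := hx.2
  refine ⟨‖c‖ * C, ?_⟩
  rintro _ ⟨p, rfl⟩
  rw [iccDeriv_smul, holderQuot_smul]
  exact mul_le_mul_of_nonneg_left (hC ⟨p, rfl⟩) (norm_nonneg _)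

theorem IsHolder.zero : IsHolder hab n α (0 : Icc a b → ℂ) := by
  have h0 : iccDeriv hab n (0 : Icc a b → ℂ) = 0 := by
    simpa using iccDeriv_smul (hab := hab) (x := 0) (0 : ℂ) n
  refine ⟨contDiffOn_const (c := (0 : ℂ)), 0, ?_⟩
  rintro _ ⟨p, rfl⟩
  rw [h0]
  simp [holderQuot]

/-- The continuity of the derivatives makes them bounded on `[a, b]`. -/
theorem bddAbove_iccDeriv (hx : ContDiffOn ℝ n (IccExtend hab.le x) (Icc a b)) {j : ℕ}
    (hj : j ≤ n) : BddAbove (range fun t => ‖iccDeriv hab j x t‖) := by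
  have hc : ContinuousOn (iteratedDerivWithin j (IccExtend hab.le x) (Icc a b)) (Icc a b) :=
    hx.continuousOn_iteratedDerivWithin (by exact_mod_cast hj) (uniqueDiffOn_Icc hab)
  obtain ⟨C, hC⟩ := isCompact_Icc.exists_bound_of_continuousOn hc
  exact ⟨C, by rintro _ ⟨t, rfl⟩; exact hC t t.2⟩

end HolderFacts

/-- The Hölder functions form a linear subspace of the functions `[a, b] → ℂ`. -/
def holderSubmodule {a b : ℝ} (hab : a < b) (n : ℕ) (α : ℝ) : Submodule ℂ (Icc a b → ℂ) where
  carrier := {x | IsHolder hab n α x}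
  add_mem' := IsHolder.add
  zero_mem' := IsHolder.zero
  smul_mem' c _ := IsHolder.smul c

/-- The complex Hölder space `C^{n,α}([a, b], ℂ)`. -/
def HolderSpace {a b : ℝ} (hab : a < b) (n : ℕ) (α : ℝ) : Type :=
  ↥(holderSubmodule hab n α)

namespace HolderSpace

variable {a b : ℝ} {hab : a < b} {n : ℕ} {α : ℝ}

instance : AddCommGroup (HolderSpace hab n α) :=
  inferInstanceAs (AddCommGroup ↥(holderSubmodule hab n α))

instance : Module ℂ (HolderSpace hab n α) :=
  inferInstanceAs (Module ℂ ↥(holderSubmodule hab n α))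

/-- The underlying function `[a, b] → ℂ`. -/
def toFun (x : HolderSpace hab n α) : Icc a b → ℂ := x.1

/-- The bundled Hölder function given by a function `[a, b] → ℂ`. -/
def mk (x : Icc a b → ℂ) (hx : IsHolder hab n α x) : HolderSpace hab n α := ⟨x, hx⟩

theorem isHolder (x : HolderSpace hab n α) : IsHolder hab n α x.toFun := x.2

theorem ext {x y : HolderSpace hab n α} (h : ∀ t, x.toFun t = y.toFun t) : x = y :=
  Subtype.ext (funext h)

/-- `‖x‖_{n,α} = ∑_{j=0}^{n} max |x^{(j)}| + sup_{t₁<t₂} |x^{(n)}(t₂)-x^{(n)}(t₁)| / |t₂-t₁|^α`. -/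
noncomputable instance : Norm (HolderSpace hab n α) where
  norm x := ∑ j ∈ Finset.range (n + 1), (⨆ t, ‖iccDeriv hab j x.toFun t‖) +
    ⨆ p, holderQuot α (iccDeriv hab n x.toFun) p

theorem norm_def (x : HolderSpace hab n α) :
    ‖x‖ = ∑ j ∈ Finset.range (n + 1), (⨆ t, ‖iccDeriv hab j x.toFun t‖) +
      ⨆ p, holderQuot α (iccDeriv hab n x.toFun) p := rfl

theorem core : NormedSpace.Core ℂ (HolderSpace hab n α) := by
  have : Nonempty (Icc a b) := ⟨⟨a, left_mem_Icc.2 hab.le⟩⟩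
  have : Nonempty {p : Icc a b × Icc a b // p.1 < p.2} :=
    ⟨⟨(⟨a, left_mem_Icc.2 hab.le⟩, ⟨b, right_mem_Icc.2 hab.le⟩), hab⟩⟩
  have hs0 : ∀ (x : HolderSpace hab n α) (j : ℕ), 0 ≤ ⨆ t, ‖iccDeriv hab j x.toFun t‖ :=
    fun x j => Real.iSup_nonneg fun _ => norm_nonneg _
  have hq0 : ∀ x : HolderSpace hab n α, 0 ≤ ⨆ p, holderQuot α (iccDeriv hab n x.toFun) p :=
    fun x => Real.iSup_nonneg fun p => holderQuot_nonneg p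
  refine { norm_nonneg := ?_, norm_smul := ?_, norm_triangle := ?_, norm_eq_zero_iff := ?_ }
  · intro x
    exact add_nonneg (Finset.sum_nonneg fun j _ => hs0 x j) (hq0 x)
  · intro c x
    have h1 : (c • x).toFun = c • x.toFun := rfl
    simp only [norm_def, h1, iccDeriv_smul, holderQuot_smul, Pi.smul_apply, _root_.norm_smul]
    rw [mul_add, Finset.mul_sum, Real.mul_iSup_of_nonneg (norm_nonneg c)]
    simp only [Real.mul_iSup_of_nonneg (norm_nonneg c)]
  · intro x y
    have h1 : (x + y).toFun = x.toFun + y.toFun := rfl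
    rw [norm_def, norm_def, norm_def, add_add_add_comm, ← Finset.sum_add_distrib]
    refine add_le_add (Finset.sum_le_sum fun j hj => ?_) ?_
    · have hj' : j ≤ n := Nat.lt_succ_iff.1 (Finset.mem_range.1 hj)
      rw [h1, iccDeriv_add x.isHolder.1 y.isHolder.1 hj']
      refine ciSup_le fun t => (norm_add_le _ _).trans (add_le_add ?_ ?_)
      · exact le_ciSup (bddAbove_iccDeriv x.isHolder.1 hj') t
      · exact le_ciSup (bddAbove_iccDeriv y.isHolder.1 hj') t
    · rw [h1, iccDeriv_add x.isHolder.1 y.isHolder.1 le_rfl]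
      exact ciSup_le fun p => (holderQuot_add_le p).trans
        (add_le_add (le_ciSup x.isHolder.2 p) (le_ciSup y.isHolder.2 p))
  · intro x
    constructor
    · intro h
      rw [norm_def] at h
      have h2 : ∑ j ∈ Finset.range (n + 1), (⨆ t, ‖iccDeriv hab j x.toFun t‖) = 0 :=
        le_antisymm (by linarith [hq0 x]) (Finset.sum_nonneg fun j _ => hs0 x j)
      have h3 := (Finset.sum_eq_zero_iff_of_nonneg fun j _ => hs0 x j).1 h2 0 (by simp)
      refine ext fun t => ?_
      have h4 := le_ciSup (bddAbove_iccDeriv (hab := hab) x.isHolder.1 (Nat.zero_le n)) t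
      rw [h3, iccDeriv_zero] at h4
      exact norm_le_zero_iff.1 h4
    · rintro rfl
      have h0 : ∀ j, iccDeriv hab j (0 : HolderSpace hab n α).toFun = 0 := fun j => by
        change iccDeriv hab j (0 : Icc a b → ℂ) = 0
        simpa using iccDeriv_smul (hab := hab) (x := 0) (0 : ℂ) j
      simp [norm_def, h0, holderQuot]

noncomputable instance : NormedAddCommGroup (HolderSpace hab n α) :=
  NormedAddCommGroup.ofCore core

noncomputable instance : NormedSpace ℂ (HolderSpace hab n α) :=
  NormedSpace.ofCore core

end HolderSpace

section OperatorFacts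

variable {a b : ℝ} {hab : a < b} {n : ℕ} {α : ℝ} {x y : Icc a b → ℂ}

theorem isHolder_zero_iff :
    IsHolder hab 0 α x ↔ Continuous x ∧ BddAbove (range (holderQuot α x)) := by
  have h : ContDiffOn ℝ (0 : ℕ) (IccExtend hab.le x) (Icc a b) ↔ Continuous x := by
    rw [Nat.cast_zero, contDiffOn_zero]
    constructor
    · intro h
      have h1 := continuousOn_iff_continuous_domRestrict.1 h
      convert h1 using 1
      funext t
      exact (iccExtend_coe (hab := hab) t).symm
    · intro h
      exact (h.Icc_extend').continuousOn
  constructor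
  · rintro ⟨h1, h2⟩
    rw [iccDeriv_zero] at h2
    exact ⟨h.1 h1, h2⟩
  · rintro ⟨h1, h2⟩
    refine ⟨h.2 h1, ?_⟩
    rwa [iccDeriv_zero]

theorem isHolder_succ_iff :
    IsHolder hab (n + 1) α x ↔ DifferentiableOn ℝ (IccExtend hab.le x) (Icc a b) ∧
      IsHolder hab n α (iccDeriv hab 1 x) := by
  have h : ContDiffOn ℝ ((n + 1 : ℕ) : WithTop ℕ∞) (IccExtend hab.le x) (Icc a b) ↔
      DifferentiableOn ℝ (IccExtend hab.le x) (Icc a b) ∧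
        ContDiffOn ℝ n (IccExtend hab.le (iccDeriv hab 1 x)) (Icc a b) := by
    rw [contDiffOn_congr iccExtend_iccDeriv_one_eqOn, Nat.cast_succ,
      contDiffOn_succ_iff_derivWithin (uniqueDiffOn_Icc hab)]
    simp
  constructor
  · rintro ⟨h1, h2⟩
    rw [iccDeriv_succ] at h2
    exact ⟨(h.1 h1).1, (h.1 h1).2, h2⟩
  · rintro ⟨h1, h2, h3⟩
    refine ⟨h.2 ⟨h1, h2⟩, ?_⟩
    rwa [iccDeriv_succ]

theorem bddAbove_norm_of_continuous (hx : Continuous x) : ∃ C, ∀ t, ‖x t‖ ≤ C := by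
  obtain ⟨C, hC⟩ := isCompact_univ.exists_bound_of_continuousOn hx.continuousOn
  exact ⟨C, fun t => hC t (mem_univ t)⟩

theorem IsHolder.mul_zero_order (hx : IsHolder hab 0 α x) (hy : IsHolder hab 0 α y) :
    IsHolder hab 0 α (x * y) := by
  rw [isHolder_zero_iff] at *
  obtain ⟨hxc, C, hC⟩ := hx
  obtain ⟨hyc, D, hD⟩ := hy
  obtain ⟨M, hM⟩ := bddAbove_norm_of_continuous hxc
  obtain ⟨N, hN⟩ := bddAbove_norm_of_continuous hyc
  refine ⟨hxc.mul hyc, M * D + C * N, ?_⟩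
  rintro _ ⟨p, rfl⟩
  have h1 : holderQuot α x p ≤ C := hC ⟨p, rfl⟩
  have h2 : holderQuot α y p ≤ D := hD ⟨p, rfl⟩
  have h0 : holderQuot α (x * y) p ≤
      ‖x p.1.2‖ * holderQuot α y p + holderQuot α x p * ‖y p.1.1‖ := by
    unfold holderQuot
    rw [← mul_div_assoc, div_mul_eq_mul_div, ← add_div]
    gcongr
    rw [← norm_mul, ← norm_mul]
    refine le_trans (le_of_eq ?_) (norm_add_le _ _)
    congr 1
    simp only [Pi.mul_apply]
    ring
  have hM0 : 0 ≤ M := (norm_nonneg _).trans (hM p.1.2)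
  have hC0 : 0 ≤ C := (holderQuot_nonneg p).trans h1
  exact h0.trans (add_le_add (mul_le_mul (hM _) h2 (holderQuot_nonneg p) hM0)
    (mul_le_mul h1 (hN _) (norm_nonneg _) hC0))

/-- `C^{n+1,α} ⊆ C^{n,α}`, since `α ≤ 1`. -/
theorem IsHolder.of_succ (hα : α ≤ 1) (hx : IsHolder hab (n + 1) α x) : IsHolder hab n α x := by
  induction n generalizing x with
  | succ k ih =>
    rw [isHolder_succ_iff] at hx ⊢
    exact ⟨hx.1, ih hx.2⟩
  | zero =>
    have hd := (isHolder_succ_iff.1 hx).1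
    obtain ⟨M, hM⟩ := bddAbove_norm_of_continuous (isHolder_zero_iff.1 (isHolder_succ_iff.1 hx).2).1
    refine ⟨hx.1.of_le (by norm_num), M * (b - a) ^ (1 - α), ?_⟩
    rw [iccDeriv_zero]
    rintro _ ⟨⟨⟨s, t⟩, hst⟩, rfl⟩
    have hst' : (0 : ℝ) < (t : ℝ) - s := sub_pos.2 hst
    have h1 : ‖IccExtend hab.le x t - IccExtend hab.le x s‖ ≤ M * ‖(t : ℝ) - s‖ := by
      refine (convex_Icc a b).norm_image_sub_le_of_norm_derivWithin_le hd (fun u hu => ?_) s.2 t.2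
      rw [← iccExtend_iccDeriv_one_eqOn hu, IccExtend_of_mem hab.le _ hu]
      exact hM _
    rw [iccExtend_coe (hab := hab), iccExtend_coe (hab := hab), Real.norm_eq_abs, abs_of_pos hst'] at h1
    have hM0 : 0 ≤ M := (norm_nonneg _).trans (hM s)
    unfold holderQuot
    simp only
    rw [abs_of_pos hst', div_le_iff₀ (Real.rpow_pos_of_pos hst' _)]
    refine h1.trans ?_
    rw [mul_assoc]
    refine mul_le_mul_of_nonneg_left ?_ hM0
    have h2 : ((t : ℝ) - s) = ((t : ℝ) - s) ^ (1 - α) * ((t : ℝ) - s) ^ α := by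
      rw [← Real.rpow_add hst']
      simp
    have h3 : (t : ℝ) - s ≤ b - a := sub_le_sub t.2.2 s.2.1
    calc ((t : ℝ) - s) = ((t : ℝ) - s) ^ (1 - α) * ((t : ℝ) - s) ^ α := h2
      _ ≤ _ := mul_le_mul_of_nonneg_right
        (Real.rpow_le_rpow hst'.le h3 (sub_nonneg.2 hα)) (Real.rpow_nonneg hst'.le _)

theorem IsHolder.of_add (hα : α ≤ 1) (k : ℕ) (hx : IsHolder hab (n + k) α x) :
    IsHolder hab n α x := by
  induction k with
  | zero => exact hx
  | succ k ih => exact ih (IsHolder.of_succ hα hx)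

theorem IsHolder.iccDeriv (j : ℕ) (hx : IsHolder hab (n + j) α x) :
    IsHolder hab n α (iccDeriv hab j x) := by
  induction j generalizing x with
  | zero => rwa [iccDeriv_zero]
  | succ j ih =>
    rw [iccDeriv_succ]
    exact ih (isHolder_succ_iff.1 hx).2

theorem IsHolder.iccDeriv_of_le (hα : α ≤ 1) {r j : ℕ} (hj : j ≤ r)
    (hx : IsHolder hab (n + r) α x) : IsHolder hab n α (_root_.iccDeriv hab j x) := by
  refine IsHolder.iccDeriv j (IsHolder.of_add hα (r - j) ?_)
  rwa [show n + j + (r - j) = n + r by omega]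

/-- `C^{n,α}` is closed under products. -/
theorem IsHolder.mul (hα : α ≤ 1) (hx : IsHolder hab n α x) (hy : IsHolder hab n α y) :
    IsHolder hab n α (x * y) := by
  induction n generalizing x y with
  | zero => exact hx.mul_zero_order hy
  | succ n ih =>
    have hx' := isHolder_succ_iff.1 hx
    have hy' := isHolder_succ_iff.1 hy
    have hd : _root_.iccDeriv hab 1 (x * y) =
        _root_.iccDeriv hab 1 x * y + x * _root_.iccDeriv hab 1 y := by
      funext t
      have h1 := derivWithin_fun_mul (hx'.1 t t.2) (hy'.1 t t.2)
      rw [iccExtend_coe (hab := hab), iccExtend_coe (hab := hab)] at h1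
      simp only [_root_.iccDeriv, Pi.add_apply, Pi.mul_apply, iteratedDerivWithin_one]
      exact h1
    rw [isHolder_succ_iff, hd]
    exact ⟨hx'.1.mul hy'.1, (ih hx'.2 (hy.of_succ hα)).add (ih (hx.of_succ hα) hy'.2)⟩

theorem IsHolder.sum {ι : Type} (s : Finset ι) {z : ι → Icc a b → ℂ}
    (hz : ∀ i, IsHolder hab n α (z i)) : IsHolder hab n α (∑ i ∈ s, z i) :=
  (holderSubmodule hab n α).sum_mem fun i _ => hz i

end OperatorFacts

/-- `(C^{n,α})^m`, normed by the sum of the norms of the entries. -/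
abbrev HolderVec {a b : ℝ} (hab : a < b) (m n : ℕ) (α : ℝ) : Type :=
  PiLp 1 fun _ : Fin m => HolderSpace hab n α

/-- `(C^{n,α})^{m × m}`. -/
abbrev HolderMat {a b : ℝ} (hab : a < b) (m n : ℕ) (α : ℝ) : Type :=
  Matrix (Fin m) (Fin m) (HolderSpace hab n α)

/-- The norm of `(C^{n,α})^{m × m}`: the sum of the norms of the entries. -/
noncomputable def holderMatNorm {a b : ℝ} {hab : a < b} {m n : ℕ} {α : ℝ}
    (M : HolderMat hab m n α) : ℝ := ∑ i, ∑ k, ‖M i k‖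

section BoundaryProblem

variable {a b : ℝ} {hab : a < b} {m n r : ℕ} {α : ℝ}

/-- The `i`-th entry of the function `y^{(r)} + ∑_{j=0}^{r-1} A_j y^{(j)}`. -/
noncomputable def diffOpFun (A : Fin r → HolderMat hab m n α) (y : HolderVec hab m (n + r) α)
    (i : Fin m) : Icc a b → ℂ := fun t =>
  iccDeriv hab r (y i).toFun t +
    ∑ j : Fin r, ∑ k : Fin m, (A j i k).toFun t * iccDeriv hab (j : ℕ) (y k).toFun t

theorem isHolder_diffOpFun (hα : α ≤ 1) (A : Fin r → HolderMat hab m n α)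
    (y : HolderVec hab m (n + r) α) (i : Fin m) : IsHolder hab n α (diffOpFun A y i) := by
  have h : diffOpFun A y i = iccDeriv hab r (y i).toFun +
      ∑ j : Fin r, ∑ k : Fin m, (A j i k).toFun * iccDeriv hab (j : ℕ) (y k).toFun := by
    funext t
    simp [diffOpFun, Finset.sum_apply]
  rw [h]
  exact ((y i).isHolder.iccDeriv_of_le hα le_rfl).add
    (IsHolder.sum _ fun j => IsHolder.sum _ fun k =>
      (A j i k).isHolder.mul hα ((y k).isHolder.iccDeriv_of_le hα j.2.le))

/-- The differential operator `L y = y^{(r)} + ∑_{j=0}^{r-1} A_j y^{(j)}` from `(C^{n+r,α})^m`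
to `(C^{n,α})^m`. -/
noncomputable def diffOp (hα : α ≤ 1) (A : Fin r → HolderMat hab m n α)
    (y : HolderVec hab m (n + r) α) : HolderVec hab m n α :=
  WithLp.toLp 1 fun i => HolderSpace.mk (diffOpFun A y i) (isHolder_diffOpFun hα A y i)

/-- The discrepancy `‖L y - f‖_{n,α} + |B y - c|` of `y` as an approximate solution of the
boundary-value problem `L y = f`, `B y = c`. -/
noncomputable def discrepancy (hα : α ≤ 1) (A : Fin r → HolderMat hab m n α)
    (B : HolderVec hab m (n + r) α →L[ℂ] EuclideanSpace ℂ (Fin (r * m)))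
    (f : HolderVec hab m n α) (c : EuclideanSpace ℂ (Fin (r * m)))
    (y : HolderVec hab m (n + r) α) : ℝ :=
  ‖diffOp hα A y - f‖ + ‖B y - c‖

/-- For each `ε ∈ [0, ε₁)` the boundary-value problem `L(ε) y = f`, `B(ε) y = c` has a unique
solution `y ∈ (C^{n+r,α})^m`, whatever the right-hand sides `f` and `c` are. -/
def UniquelySolvable (hα : α ≤ 1) (A : ℝ → Fin r → HolderMat hab m n α)
    (B : ℝ → HolderVec hab m (n + r) α →L[ℂ] EuclideanSpace ℂ (Fin (r * m))) (ε₁ : ℝ) : Prop :=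
  ∀ ε ∈ Ico 0 ε₁, ∀ (f : HolderVec hab m n α) (c : EuclideanSpace ℂ (Fin (r * m))),
    ∃! y : HolderVec hab m (n + r) α, diffOp hα (A ε) y = f ∧ B ε y = c

end BoundaryProblem

/-! ### Chains of derivatives and primitives on `[a, b]`. -/

section

variable {a b : ℝ} {hab : a < b} {n : ℕ} {α : ℝ}

/-! The operators `(L(ε), B(ε))` from `(C^{n+r,α})^m` to `(C^{n,α})^m × ℂ^{rm}` are perturbations of
`(L(0), B(0))`. Once they are bijective and bounded, together with their inverses, by one constant
`κ` for small `ε > 0`, the two-sided estimate is immediate: applied to `y(0) - y(ε)`, the operator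
yields exactly the residuals measured by `discrepancy`.

Bijectivity at `ε = 0` is a dimension count (`bijective_diffOpCLM_of_injective`). Initial value
problems are solvable in the Hölder scale (`exists_diffOp_eq`), so `ker L(0)` has dimension at least
`rm`; by Condition (0), `B(0)` embeds it in `ℂ^{rm}`. Hence `B(0)` maps the kernel onto `ℂ^{rm}`,
and a particular solution of `L(0) y = f` can be corrected to meet any boundary data.

Stability needs care because `B(ε)` converges only pointwise, whereas `L(ε)` converges in norm
(`tendsto_diffOpCLM`). Two facts compensate (`eventually_bijective_and_norm_le`): Banach–Steinhaus
bounds `B(ε)` uniformly, and pointwise convergence on a finite-dimensional space is norm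
convergence. After composition with the inverse at `ε = 0`, the only block of the perturbation that
need not become small is strictly triangular and bounded; a triangular factor removes it, and what
remains is a small perturbation of the identity. These arguments rest on the completeness of the
Hölder spaces. -/

theorem iccDeriv_one_eq {x x' : Icc a b → ℂ}
    (h : ∀ t : Icc a b, HasDerivWithinAt (IccExtend hab.le x) (x' t) (Icc a b) t) :
    iccDeriv hab 1 x = x' := by
  funext t
  simp only [iccDeriv, iteratedDerivWithin_one]
  exact (h t).derivWithin (uniqueDiffOn_Icc hab t t.2)

theorem hasDerivWithinAt_iccDeriv_one {x : Icc a b → ℂ}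
    (h : DifferentiableOn ℝ (IccExtend hab.le x) (Icc a b)) (t : Icc a b) :
    HasDerivWithinAt (IccExtend hab.le x) (iccDeriv hab 1 x t) (Icc a b) t := by
  simp only [iccDeriv, iteratedDerivWithin_one]
  exact (h t t.2).hasDerivWithinAt

theorem differentiableOn_of_hasDerivWithinAt {x x' : Icc a b → ℂ}
    (h : ∀ t : Icc a b, HasDerivWithinAt (IccExtend hab.le x) (x' t) (Icc a b) t) :
    DifferentiableOn ℝ (IccExtend hab.le x) (Icc a b) :=
  fun t ht => (h ⟨t, ht⟩).differentiableWithinAt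

theorem isHolder_succ_of_hasDerivWithinAt {x x' : Icc a b → ℂ}
    (h : ∀ t : Icc a b, HasDerivWithinAt (IccExtend hab.le x) (x' t) (Icc a b) t)
    (hx' : IsHolder hab n α x') : IsHolder hab (n + 1) α x :=
  isHolder_succ_iff.2 ⟨differentiableOn_of_hasDerivWithinAt (hab := hab) h, by
    rwa [iccDeriv_one_eq h]⟩

theorem norm_sub_le_of_hasDerivWithinAt {x x' : Icc a b → ℂ}
    (h : ∀ t : Icc a b, HasDerivWithinAt (IccExtend hab.le x) (x' t) (Icc a b) t) {M : ℝ}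
    (hM : ∀ t, ‖x' t‖ ≤ M) (s t : Icc a b) : ‖x t - x s‖ ≤ M * |(t : ℝ) - s| := by
  have h1 := (convex_Icc a b).norm_image_sub_le_of_norm_hasDerivWithin_le
    (f := IccExtend hab.le x) (f' := IccExtend hab.le x') (C := M)
    (fun u hu => by rw [IccExtend_of_mem hab.le _ hu]; exact h ⟨u, hu⟩)
    (fun u hu => by rw [IccExtend_of_mem hab.le _ hu]; exact hM _) s.2 t.2
  rwa [iccExtend_coe (hab := hab), iccExtend_coe (hab := hab)] at h1

/-- A function with a bounded derivative is Hölder continuous with every exponent `α ≤ 1`. -/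
theorem isHolder_zero_of_hasDerivWithinAt (hα : α ≤ 1) {x x' : Icc a b → ℂ}
    (h : ∀ t : Icc a b, HasDerivWithinAt (IccExtend hab.le x) (x' t) (Icc a b) t) {M : ℝ}
    (hM : ∀ t, ‖x' t‖ ≤ M) : IsHolder hab 0 α x := by
  have hc : ContinuousOn (IccExtend hab.le x) (Icc a b) :=
    (differentiableOn_of_hasDerivWithinAt (hab := hab) h).continuousOn
  refine ⟨contDiffOn_zero.2 hc, M * (b - a) ^ (1 - α), ?_⟩
  rw [iccDeriv_zero]
  rintro _ ⟨⟨⟨s, t⟩, hst⟩, rfl⟩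
  have hst' : (0 : ℝ) < (t : ℝ) - s := sub_pos.2 hst
  have h1 := norm_sub_le_of_hasDerivWithinAt (hab := hab) h hM s t
  have hM0 : 0 ≤ M := (norm_nonneg _).trans (hM s)
  simp only [holderQuot]
  rw [abs_of_pos hst'] at h1 ⊢
  rw [div_le_iff₀ (Real.rpow_pos_of_pos hst' _)]
  refine h1.trans ?_
  rw [mul_assoc]
  refine mul_le_mul_of_nonneg_left ?_ hM0
  have h3 : (t : ℝ) - s ≤ b - a := sub_le_sub t.2.2 s.2.1
  calc ((t : ℝ) - s) = ((t : ℝ) - s) ^ (1 - α) * ((t : ℝ) - s) ^ α := by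
        rw [← Real.rpow_add hst']
        simp
    _ ≤ _ := mul_le_mul_of_nonneg_right
      (Real.rpow_le_rpow hst'.le h3 (sub_nonneg.2 hα)) (Real.rpow_nonneg hst'.le _)

theorem hasDerivWithinAt_primitive {z : Icc a b → ℂ} (hz : Continuous z) (c : ℂ) (t : Icc a b) :
    HasDerivWithinAt (IccExtend hab.le
      fun s : Icc a b => c + ∫ u in a..(s : ℝ), IccExtend hab.le z u) (z t) (Icc a b) t := by
  have hz' : Continuous (IccExtend hab.le z) := hz.Icc_extend'
  have h1 : HasDerivAt (fun s : ℝ => c + ∫ u in a..s, IccExtend hab.le z u)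
      (IccExtend hab.le z t) t :=
    (intervalIntegral.integral_hasDerivAt_right (hz'.intervalIntegrable _ _)
      (hz'.stronglyMeasurableAtFilter _ _) hz'.continuousAt).const_add c
  rw [iccExtend_coe (hab := hab)] at h1
  refine h1.hasDerivWithinAt.congr (fun s hs => ?_) ?_
  · rw [IccExtend_of_mem hab.le _ hs]
  · rw [iccExtend_coe (hab := hab)]

/-- Converts a solution of a first-order system, whose components form a chain `w 0, w 1, …` of
successive derivatives, back into higher derivatives of `w 0`. The induction removes the head of the
chain. -/
theorem iccDeriv_eq_of_hasDerivWithinAt {r : ℕ} {w : ℕ → Icc a b → ℂ}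
    (h : ∀ j < r, ∀ t : Icc a b,
      HasDerivWithinAt (IccExtend hab.le (w j)) (w (j + 1) t) (Icc a b) t) :
    ∀ j ≤ r, iccDeriv hab j (w 0) = w j := by
  intro j
  induction j generalizing r w with
  | zero => exact fun _ => iccDeriv_zero
  | succ j ih =>
    intro hj
    rw [iccDeriv_succ, iccDeriv_one_eq (h 0 (by omega))]
    exact ih (r := r - 1) (w := fun i => w (i + 1)) (fun i hi => h (i + 1) (by omega)) (by omega)

/-- Each step down the chain from its top gains one order of smoothness. -/
theorem isHolder_of_hasDerivWithinAt {r : ℕ} {w : ℕ → Icc a b → ℂ}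
    (h : ∀ j < r, ∀ t : Icc a b,
      HasDerivWithinAt (IccExtend hab.le (w j)) (w (j + 1) t) (Icc a b) t)
    (hw : IsHolder hab n α (w r)) {i j : ℕ} (hij : j + i = r) : IsHolder hab (n + i) α (w j) := by
  induction i generalizing j with
  | zero => rwa [show j = r by omega]
  | succ i ih =>
    exact isHolder_succ_of_hasDerivWithinAt (h j (by omega)) (ih (j := j + 1) (by omega))

end

/-! ### Completeness of the Hölder spaces. -/

namespace HolderSpace

variable {a b : ℝ} {hab : a < b} {n : ℕ} {α : ℝ}

theorem continuous_toFun (x : HolderSpace hab n α) : Continuous x.toFun := by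
  have h1 := continuousOn_iff_continuous_domRestrict.1 x.isHolder.1.continuousOn
  convert h1 using 1
  funext t
  exact (iccExtend_coe (hab := hab) t).symm

theorem norm_iccDeriv_le (x : HolderSpace hab n α) {j : ℕ} (hj : j ≤ n) (t : Icc a b) :
    ‖iccDeriv hab j x.toFun t‖ ≤ ‖x‖ := by
  rw [norm_def]
  have h1 : ‖iccDeriv hab j x.toFun t‖ ≤ ⨆ t, ‖iccDeriv hab j x.toFun t‖ :=
    le_ciSup (bddAbove_iccDeriv x.isHolder.1 hj) t
  have h2 := Finset.single_le_sum (f := fun j => ⨆ t, ‖iccDeriv hab j x.toFun t‖)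
    (fun i _ => Real.iSup_nonneg fun _ => norm_nonneg _) (Finset.mem_range.2 (Nat.lt_succ_of_le hj))
  have h3 : 0 ≤ ⨆ p, holderQuot α (iccDeriv hab n x.toFun) p :=
    Real.iSup_nonneg fun p => holderQuot_nonneg p
  linarith

theorem norm_toFun_le (x : HolderSpace hab n α) (t : Icc a b) : ‖x.toFun t‖ ≤ ‖x‖ := by
  simpa [iccDeriv_zero] using x.norm_iccDeriv_le (Nat.zero_le n) t

/-- The value of the `j`-th derivative at a point, as a bounded linear functional. -/
noncomputable def derivAt (j : ℕ) (hj : j ≤ n) (t : Icc a b) : HolderSpace hab n α →L[ℂ] ℂ :=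
  LinearMap.mkContinuous
    { toFun := fun x => iccDeriv hab j x.toFun t
      map_add' := fun x y => congrFun (iccDeriv_add x.isHolder.1 y.isHolder.1 hj) t
      map_smul' := fun c x => congrFun (iccDeriv_smul (x := x.toFun) c j) t } 1
    fun x => by rw [one_mul]; exact x.norm_iccDeriv_le hj t

@[simp]
theorem derivAt_apply (j : ℕ) (hj : j ≤ n) (t : Icc a b) (x : HolderSpace hab n α) :
    derivAt j hj t x = iccDeriv hab j x.toFun t := rfl

theorem tendsto_toFun {ι : Type*} {l : Filter ι} {u : ι → HolderSpace hab n α}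
    {x : HolderSpace hab n α} (h : Tendsto u l (𝓝 x)) (t : Icc a b) :
    Tendsto (fun i => (u i).toFun t) l (𝓝 (x.toFun t)) := by
  have := ((derivAt 0 (Nat.zero_le n) t).continuous.tendsto x).comp h
  simpa [Function.comp_def, iccDeriv_zero] using this

theorem toFun_sub (x y : HolderSpace hab n α) (t : Icc a b) :
    (x - y).toFun t = x.toFun t - y.toFun t := rfl

theorem toFun_add (x y : HolderSpace hab n α) (t : Icc a b) :
    (x + y).toFun t = x.toFun t + y.toFun t := rfl

theorem toFun_sum {ι : Type*} (s : Finset ι) (u : ι → HolderSpace hab n α) (t : Icc a b) :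
    (∑ i ∈ s, u i).toFun t = ∑ i ∈ s, (u i).toFun t := by
  classical
  induction s using Finset.induction_on with
  | empty => rfl
  | insert i s hi ih => rw [Finset.sum_insert hi, Finset.sum_insert hi, toFun_add, ih]

theorem norm_le_of_forall_le (x : HolderSpace hab 0 α) {C D : ℝ} (hC : ∀ t, ‖x.toFun t‖ ≤ C)
    (hD : ∀ p, holderQuot α x.toFun p ≤ D) : ‖x‖ ≤ C + D := by
  have : Nonempty (Icc a b) := ⟨⟨a, left_mem_Icc.2 hab.le⟩⟩
  have : Nonempty {p : Icc a b × Icc a b // p.1 < p.2} :=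
    ⟨⟨(⟨a, left_mem_Icc.2 hab.le⟩, ⟨b, right_mem_Icc.2 hab.le⟩), hab⟩⟩
  rw [norm_def]
  simp only [zero_add, Finset.range_one, Finset.sum_singleton, iccDeriv_zero]
  exact add_le_add (ciSup_le hC) (ciSup_le hD)

theorem holderQuot_le_norm (x : HolderSpace hab 0 α) (p) : holderQuot α x.toFun p ≤ ‖x‖ := by
  rw [norm_def]
  have h1 := le_ciSup x.isHolder.2 p
  have h2 : 0 ≤ ⨆ t, ‖iccDeriv hab 0 x.toFun t‖ := Real.iSup_nonneg fun _ => norm_nonneg _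
  simp only [zero_add, Finset.range_one, Finset.sum_singleton]
  rw [iccDeriv_zero] at *
  linarith

/-- A Cauchy sequence has a pointwise limit, and both the sup bound and each Hölder quotient bound
survive pointwise limits. -/
theorem completeSpace_zero : CompleteSpace (HolderSpace hab 0 α) := by
  refine Metric.complete_of_cauchySeq_tendsto fun u hu => ?_
  have hpt : ∀ t, ∃ z, Tendsto (fun k => (u k).toFun t) atTop (𝓝 z) := fun t => by
    refine cauchySeq_tendsto_of_complete ?_
    have := (derivAt (hab := hab) (α := α) 0 le_rfl t).uniformContinuous.comp_cauchySeq hu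
    simpa [Function.comp_def, iccDeriv_zero] using this
  choose x hx using hpt
  have hlim : ∀ ε > 0, ∃ N, ∀ k ≥ N, (∀ t, ‖(u k).toFun t - x t‖ ≤ ε) ∧
      ∀ p, holderQuot α (fun t => (u k).toFun t - x t) p ≤ ε := by
    intro ε hε
    obtain ⟨N, hN⟩ := Metric.cauchySeq_iff.1 hu ε hε
    refine ⟨N, fun k hk => ⟨fun t => ?_, fun p => ?_⟩⟩
    · refine le_of_tendsto (tendsto_const_nhds.sub (hx t)).norm ?_
      filter_upwards [eventually_ge_atTop N] with l hl
      have h1 := hN k hk l hl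
      rw [dist_eq_norm] at h1
      exact (norm_toFun_le (u k - u l) t).trans h1.le
    · have h2 : Tendsto (fun l => holderQuot α (fun t => (u k).toFun t - (u l).toFun t) p) atTop
          (𝓝 (holderQuot α (fun t => (u k).toFun t - x t) p)) := by
        unfold holderQuot
        exact (((tendsto_const_nhds.sub (hx _)).sub
          (tendsto_const_nhds.sub (hx _))).norm).div_const _
      refine le_of_tendsto h2 ?_
      filter_upwards [eventually_ge_atTop N] with l hl
      have h1 := hN k hk l hl
      rw [dist_eq_norm] at h1
      exact (holderQuot_le_norm (u k - u l) p).trans h1.le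
  have hxc : Continuous x := by
    have h1 : TendstoUniformly (fun k t => (u k).toFun t) x atTop := by
      rw [Metric.tendstoUniformly_iff]
      intro ε hε
      obtain ⟨N, hN⟩ := hlim (ε / 2) (half_pos hε)
      filter_upwards [eventually_ge_atTop N] with k hk t
      rw [dist_comm, dist_eq_norm]
      exact ((hN k hk).1 t).trans_lt (half_lt_self hε)
    exact h1.continuous (Frequently.of_forall fun k => (u k).continuous_toFun)
  have hxh : IsHolder hab 0 α x := by
    refine isHolder_zero_iff.2 ⟨hxc, ?_⟩
    obtain ⟨N, hN⟩ := hlim 1 one_pos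
    refine ⟨‖u N‖ + 1, ?_⟩
    rintro _ ⟨p, rfl⟩
    -- The limit inherits bounded Hölder quotients from a single `u N`, since the error `u N - x`
    -- has quotients at most `1`.
    have h1 : x = (u N).toFun + (-1 : ℂ) • fun t => (u N).toFun t - x t := by
      funext t
      simp
    rw [h1]
    refine (holderQuot_add_le p).trans (add_le_add (holderQuot_le_norm _ p) ?_)
    rw [holderQuot_smul]
    simpa using (hN N le_rfl).2 p
  refine ⟨mk x hxh, Metric.tendsto_atTop.2 fun ε hε => ?_⟩
  obtain ⟨N, hN⟩ := hlim (ε / 4) (by positivity)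
  refine ⟨N, fun k hk => ?_⟩
  rw [dist_eq_norm]
  have h1 := norm_le_of_forall_le (u k - mk x hxh) (hN k hk).1 (hN k hk).2
  linarith

/-- All terms of the norm of `x` except the sup of `x` itself add up to the norm of the derivative
`z`; that sup is controlled by the mean value inequality from the left end point, at the cost `b -
a`. -/
theorem norm_succ_le (x : HolderSpace hab (n + 1) α) (z : HolderSpace hab n α)
    (hz : ∀ t : Icc a b, HasDerivWithinAt (IccExtend hab.le x.toFun) (z.toFun t) (Icc a b) t) :
    ‖x‖ ≤ ‖x.toFun ⟨a, left_mem_Icc.2 hab.le⟩‖ + (b - a + 1) * ‖z‖ := by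
  have : Nonempty (Icc a b) := ⟨⟨a, left_mem_Icc.2 hab.le⟩⟩
  have hs : ∀ j, iccDeriv hab (j + 1) x.toFun = iccDeriv hab j z.toFun := fun j => by
    rw [iccDeriv_succ, iccDeriv_one_eq hz]
  rw [norm_def, Finset.sum_range_succ']
  simp only [hs]
  have h1 : ⨆ t, ‖iccDeriv hab 0 x.toFun t‖ ≤
      ‖x.toFun ⟨a, left_mem_Icc.2 hab.le⟩‖ + (b - a) * ‖z‖ := by
    refine ciSup_le fun t => ?_
    rw [iccDeriv_zero]
    have h2 := norm_sub_le_of_hasDerivWithinAt (hab := hab) hz z.norm_toFun_le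
      ⟨a, left_mem_Icc.2 hab.le⟩ t
    have h3 : |(t : ℝ) - a| ≤ b - a := by
      rw [abs_of_nonneg (sub_nonneg.2 t.2.1)]
      exact sub_le_sub_right t.2.2 a
    have h4 := norm_le_norm_add_norm_sub' (x.toFun t) (x.toFun ⟨a, left_mem_Icc.2 hab.le⟩)
    have h5 := mul_le_mul_of_nonneg_left h3 (norm_nonneg z)
    dsimp only at h2
    linarith
  have h6 := norm_def z
  linarith

theorem norm_le_norm_succ (x : HolderSpace hab (n + 1) α) (z : HolderSpace hab n α)
    (hz : z.toFun = iccDeriv hab 1 x.toFun) : ‖z‖ ≤ ‖x‖ := by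
  rw [norm_def, norm_def, Finset.sum_range_succ' _ (n + 1), hz]
  simp only [← iccDeriv_succ]
  have h0 : 0 ≤ ⨆ t, ‖iccDeriv hab 0 x.toFun t‖ := Real.iSup_nonneg fun _ => norm_nonneg _
  linarith

/-- The derivatives converge one order lower and the values at `a` converge; the limit is the
primitive of the limiting derivative with the limiting value at `a`. -/
theorem completeSpace_succ [CompleteSpace (HolderSpace hab n α)] :
    CompleteSpace (HolderSpace hab (n + 1) α) := by
  refine Metric.complete_of_cauchySeq_tendsto fun u hu => ?_
  have ha : a ∈ Icc a b := left_mem_Icc.2 hab.le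
  obtain ⟨c, hc⟩ : ∃ c, Tendsto (fun k => (u k).toFun ⟨a, ha⟩) atTop (𝓝 c) := by
    refine cauchySeq_tendsto_of_complete ?_
    have := (derivAt (hab := hab) (n := n + 1) (α := α) 0 (Nat.zero_le _)
      ⟨a, ha⟩).uniformContinuous.comp_cauchySeq hu
    simpa [Function.comp_def, iccDeriv_zero] using this
  let v : ℕ → HolderSpace hab n α := fun k =>
    mk (iccDeriv hab 1 (u k).toFun) (isHolder_succ_iff.1 (u k).isHolder).2
  have hv : CauchySeq v := by
    rw [Metric.cauchySeq_iff] at hu ⊢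
    intro ε hε
    obtain ⟨N, hN⟩ := hu ε hε
    refine ⟨N, fun k hk l hl => ?_⟩
    have h1 := hN k hk l hl
    rw [dist_eq_norm] at h1 ⊢
    refine (norm_le_norm_succ (u k - u l) _ ?_).trans_lt h1
    funext t
    exact (map_sub (derivAt 1 (by omega) t) (u k) (u l)).symm
  obtain ⟨z, hz⟩ := cauchySeq_tendsto_of_complete hv
  have hd := hasDerivWithinAt_primitive (hab := hab) z.continuous_toFun c
  let x : HolderSpace hab (n + 1) α := mk _ (isHolder_succ_of_hasDerivWithinAt hd z.isHolder)
  have hxa : x.toFun ⟨a, ha⟩ = c := by simp [x, mk, toFun]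
  refine ⟨x, tendsto_iff_norm_sub_tendsto_zero.2 ?_⟩
  have h0 : Tendsto (fun k => ‖(u k).toFun ⟨a, ha⟩ - c‖ + (b - a + 1) * ‖v k - z‖) atTop (𝓝 0) := by
    have h1 := (tendsto_iff_norm_sub_tendsto_zero.1 hc).add
      ((tendsto_iff_norm_sub_tendsto_zero.1 hz).const_mul (b - a + 1))
    simpa using h1
  refine squeeze_zero (fun _ => norm_nonneg _) (fun k => ?_) h0
  have h2 := norm_succ_le (u k - x) (v k - z) (fun t => by
    exact (hasDerivWithinAt_iccDeriv_one (hab := hab)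
      (isHolder_succ_iff.1 (u k).isHolder).1 t).sub (hd t))
  rwa [toFun_sub, hxa] at h2

instance : CompleteSpace (HolderSpace hab n α) := by
  induction n with
  | zero => exact completeSpace_zero
  | succ n ih => exact completeSpace_succ

/-! ### Differentiation and multiplication as bounded operators, by the closed graph theorem. -/

/-- Differentiation of order `j ≤ r`, from `C^{n+r,α}` to `C^{n,α}`. -/
noncomputable def derivCLM (hα : α ≤ 1) {r : ℕ} (j : ℕ) (hj : j ≤ r) :
    HolderSpace hab (n + r) α →L[ℂ] HolderSpace hab n α :=
  ContinuousLinearMap.ofSeqClosedGraph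
    (g := { toFun := fun x => mk (iccDeriv hab j x.toFun) (x.isHolder.iccDeriv_of_le hα hj)
            map_add' := fun x y => ext fun t => (derivAt j (by omega) t).map_add x y
            map_smul' := fun c x => ext fun t => (derivAt j (by omega) t).map_smul c x })
    -- Norm convergence implies pointwise convergence of functions and of derivatives, so the limit
    -- of the images is identified point by point.
    fun _ x _ hu hy => ext fun t => tendsto_nhds_unique (tendsto_toFun hy t)
      (((derivAt (n := n + r) j (by omega) t).continuous.tendsto x).comp hu)

/-- Multiplication by a fixed function of `C^{n,α}`. -/
noncomputable def mulLeftCLM (hα : α ≤ 1) (x : HolderSpace hab n α) :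
    HolderSpace hab n α →L[ℂ] HolderSpace hab n α :=
  ContinuousLinearMap.ofSeqClosedGraph
    (g := { toFun := fun y => mk (x.toFun * y.toFun) (x.isHolder.mul hα y.isHolder)
            map_add' := fun y z => ext fun t => mul_add (x.toFun t) (y.toFun t) (z.toFun t)
            map_smul' := fun c y => ext fun t => mul_left_comm (x.toFun t) c (y.toFun t) })
    fun _ _ _ hu hz => ext fun t => tendsto_nhds_unique (tendsto_toFun hz t)
      ((tendsto_toFun hu t).const_mul (x.toFun t))

/-- Multiplication in `C^{n,α}` as a bounded bilinear map. -/
noncomputable def mulCLM (hα : α ≤ 1) :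
    HolderSpace hab n α →L[ℂ] HolderSpace hab n α →L[ℂ] HolderSpace hab n α :=
  ContinuousLinearMap.ofSeqClosedGraph
    (g := { toFun := mulLeftCLM hα
            map_add' := fun x y => ContinuousLinearMap.ext fun z => ext fun t =>
              add_mul (x.toFun t) (y.toFun t) (z.toFun t)
            map_smul' := fun c x => ContinuousLinearMap.ext fun z => ext fun t =>
              mul_assoc c (x.toFun t) (z.toFun t) })
    fun u _ T hu hT => ContinuousLinearMap.ext fun z => ext fun t => by
      have h1 : Tendsto (fun k => mulLeftCLM hα (u k) z) atTop (𝓝 (T z)) :=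
        ((ContinuousLinearMap.apply ℂ _ z).continuous.tendsto T).comp hT
      exact tendsto_nhds_unique (tendsto_toFun h1 t) ((tendsto_toFun hu t).mul_const (z.toFun t))

end HolderSpace

/-! ### Global solvability of Lipschitz differential equations. -/

section

variable {E : Type*} [NormedAddCommGroup E] [NormedSpace ℝ E] [CompleteSpace E]

/-- Global existence of solutions of `z' = v(t, z)` on a compact interval, for a vector field that is
Lipschitz in `z` with a uniform constant. -/
theorem exists_hasDerivWithinAt_of_lipschitzWith {a b : ℝ} (hab : a ≤ b) {v : ℝ → E → E}
    (hv : Continuous (Function.uncurry v)) {K : NNReal} (hK : ∀ t, LipschitzWith K (v t)) (z₀ : E) :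
    ∃ z : ℝ → E, z a = z₀ ∧ ∀ t ∈ Icc a b, HasDerivWithinAt z (v t (z t)) (Icc a b) t := by
  -- The projection extends `u` continuously to `ℝ`, so that the integral is differentiable at the
  -- end points too.
  let g : C(Icc a b, E) → ℝ → E := fun u s => v s (u (projIcc a b hab s))
  have hg : ∀ u, Continuous (g u) := fun u =>
    hv.comp (continuous_id.prodMk (u.continuous.comp continuous_projIcc))
  have hd : ∀ u t, HasDerivAt (fun t => z₀ + ∫ s in a..t, g u s) (g u t) t := fun u t =>
    (intervalIntegral.integral_hasDerivAt_right ((hg u).intervalIntegrable _ _)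
      ((hg u).stronglyMeasurableAtFilter _ _) (hg u).continuousAt).const_add z₀
  let next : C(Icc a b, E) → C(Icc a b, E) := fun u =>
    ⟨fun t => z₀ + ∫ s in a..(t : ℝ), g u s,
      (continuous_iff_continuousAt.2 fun t => (hd u t).continuousAt).comp continuous_subtype_val⟩
  have hnext : ∀ u (t : Icc a b), next u t = z₀ + ∫ s in a..(t : ℝ), g u s := fun _ _ => rfl
  -- The factorial makes a high iterate of the Picard map `next` a contraction on the whole
  -- interval, without subdividing it.
  have hbound : ∀ (k : ℕ) (u w : C(Icc a b, E)) (t : Icc a b),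
      ‖next^[k] u t - next^[k] w t‖ ≤ (K * (t - a)) ^ k / k.factorial * dist u w := by
    intro k u w
    induction k with
    | zero =>
      intro t
      simpa [dist_eq_norm] using (u - w).norm_coe_le_norm t
    | succ k ih =>
      intro t
      rw [Function.iterate_succ_apply', Function.iterate_succ_apply', hnext, hnext,
        add_sub_add_left_eq_sub, ← intervalIntegral.integral_sub
          ((hg _).intervalIntegrable _ _) ((hg _).intervalIntegrable _ _)]
      have h1 : ∀ s ∈ Ioc a (t : ℝ), ‖g (next^[k] u) s - g (next^[k] w) s‖ ≤
          (K ^ (k + 1) / k.factorial * dist u w) * (s - a) ^ k := by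
        intro s hs
        have hs' : s ∈ Icc a b := ⟨hs.1.le, hs.2.trans t.2.2⟩
        have h2 := ih ⟨s, hs'⟩
        have h3 := (hK s).norm_sub_le (next^[k] u ⟨s, hs'⟩) (next^[k] w ⟨s, hs'⟩)
        simp only [g, projIcc_of_mem hab hs']
        refine h3.trans ((mul_le_mul_of_nonneg_left h2 K.coe_nonneg).trans (le_of_eq ?_))
        rw [mul_pow]
        ring
      refine (intervalIntegral.norm_integral_le_of_norm_le t.2.1
        (MeasureTheory.ae_of_all _ h1) (Continuous.intervalIntegrable (by fun_prop) _ _)).trans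
        (le_of_eq ?_)
      rw [intervalIntegral.integral_const_mul,
        intervalIntegral.integral_comp_sub_right (fun s => s ^ k), integral_pow, sub_self,
        zero_pow k.succ_ne_zero, Nat.factorial_succ, mul_pow]
      push_cast
      field_simp
      ring
  obtain ⟨k, hk⟩ := ((FloorSemiring.tendsto_pow_div_factorial_atTop (K * (b - a))).eventually
    (gt_mem_nhds zero_lt_one)).exists
  have hba : 0 ≤ b - a := sub_nonneg.2 hab
  have hC : (0 : ℝ) ≤ (K * (b - a)) ^ k / k.factorial := by positivity
  have hcontr : ContractingWith ⟨_, hC⟩ next^[k] := by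
    refine ⟨hk, LipschitzWith.of_dist_le_mul fun u w => ?_⟩
    refine (ContinuousMap.dist_le (mul_nonneg hC dist_nonneg)).2 fun t => ?_
    rw [dist_eq_norm]
    refine (hbound k u w t).trans ?_
    have h1 : 0 ≤ (t : ℝ) - a := sub_nonneg.2 t.2.1
    have h2 : (t : ℝ) ≤ b := t.2.2
    change _ ≤ (K * (b - a)) ^ k / k.factorial * dist u w
    gcongr
  -- The unique fixed point of an iterate of `next` is fixed by `next` itself.
  obtain ⟨u, hu⟩ : ∃ u, next u = u := ⟨_, hcontr.isFixedPt_fixedPoint_iterate⟩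
  refine ⟨fun t => z₀ + ∫ s in a..t, g u s, by simp, fun t ht => ?_⟩
  have h1 : g u t = v t (z₀ + ∫ s in a..t, g u s) := by
    rw [← hnext u ⟨t, ht⟩, hu]
    simp only [g, projIcc_of_mem hab ht]
  rw [← h1]
  exact (hd u t).hasDerivWithinAt

end

/-! ### Stability of bijectivity when one component converges only pointwise. -/

section

variable {ι X Y Z : Type*} {l : Filter ι} [NormedAddCommGroup X] [NormedSpace ℂ X]
  [CompleteSpace X] [NormedAddCommGroup Y] [NormedSpace ℂ Y] [CompleteSpace Y]
  [NormedAddCommGroup Z] [NormedSpace ℂ Z] {d : ℕ}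

/-- Operators converging pointwise along a countably generated filter are eventually uniformly
bounded. -/
theorem eventually_norm_le_of_tendsto_apply [l.IsCountablyGenerated] {B : ι → X →L[ℂ] Z}
    {B₀ : X →L[ℂ] Z} (hB : ∀ x, Tendsto (fun i => B i x) l (𝓝 (B₀ x))) :
    ∃ C, ∀ᶠ i in l, ‖B i‖ ≤ C := by
  by_contra! hcon
  obtain ⟨s, hs⟩ := l.exists_antitone_basis
  -- Without an eventual bound there is a sequence tending to `l` along which the norms are
  -- unbounded, contradicting the uniform boundedness principle for sequences.
  have h1 : ∀ k : ℕ, ∃ i ∈ s k, (k : ℝ) < ‖B i‖ := fun k => by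
    obtain ⟨i, hi, hi'⟩ := (hcon k).and_eventually (hs.1.mem_of_mem (i := k) trivial) |>.exists
    exact ⟨i, hi', hi⟩
  choose u hus hu using h1
  have hul : Tendsto u atTop l := hs.tendsto hus
  obtain ⟨C, hC⟩ := banach_steinhaus (g := fun k => B (u k)) fun x => by
    obtain ⟨C, hC⟩ := ((hB x).comp hul).norm.bddAbove_range
    exact ⟨C, fun k => hC ⟨k, rfl⟩⟩
  obtain ⟨k, hk⟩ := exists_nat_gt C
  linarith [hC k, hu k]

/-- In finite dimension the operator norm is bounded by the sum of the norms of the images of an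
orthonormal basis. -/
theorem tendsto_norm_zero_of_tendsto_apply {G : ι → EuclideanSpace ℂ (Fin d) →L[ℂ] Z}
    (hG : ∀ c, Tendsto (fun i => G i c) l (𝓝 0)) : Tendsto (fun i => ‖G i‖) l (𝓝 0) := by
  let e := EuclideanSpace.basisFun (Fin d) ℂ
  have h1 : Tendsto (fun i => ∑ k, ‖G i (e k)‖) l (𝓝 0) := by
    have := tendsto_finsetSum (Finset.univ : Finset (Fin d)) fun k _ => (hG (e k)).norm
    simpa using this
  refine squeeze_zero (fun _ => norm_nonneg _) (fun i => ?_) h1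
  refine (G i).opNorm_le_bound (Finset.sum_nonneg fun _ _ => norm_nonneg _) fun c => ?_
  conv_lhs => rw [← e.sum_repr c, map_sum]
  refine (norm_sum_le _ _).trans ?_
  rw [Finset.sum_mul]
  refine Finset.sum_le_sum fun k _ => ?_
  rw [map_smul, norm_smul, mul_comm]
  exact mul_le_mul_of_nonneg_left (PiLp.norm_apply_le c k) (norm_nonneg _)

/-- If `L i → L₀` in norm, `B i → B₀` pointwise with values in a finite-dimensional space, and
`(L₀, B₀)` is bijective, then eventually `(L i, B i)` is bijective, and it and its inverse are
uniformly bounded. -/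
theorem eventually_bijective_and_norm_le [l.IsCountablyGenerated] {L : ι → X →L[ℂ] Y}
    {L₀ : X →L[ℂ] Y} {B : ι → X →L[ℂ] EuclideanSpace ℂ (Fin d)}
    {B₀ : X →L[ℂ] EuclideanSpace ℂ (Fin d)} (hL : Tendsto (fun i => ‖L i - L₀‖) l (𝓝 0))
    (hB : ∀ x, Tendsto (fun i => B i x) l (𝓝 (B₀ x)))
    (h₀ : Function.Bijective fun x => (L₀ x, B₀ x)) :
    ∃ κ > 0, ∀ᶠ i in l, Function.Bijective (fun x => (L i x, B i x)) ∧
      ∀ x, ‖L i x‖ + ‖B i x‖ ≤ κ * ‖x‖ ∧ ‖x‖ ≤ κ * (‖L i x‖ + ‖B i x‖) := by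
  set F := EuclideanSpace ℂ (Fin d)
  have hinj : (L₀.prod B₀).ker = ⊥ := LinearMap.ker_eq_bot.2 h₀.1
  have hsur : (L₀.prod B₀).range = ⊤ := LinearMap.range_eq_top.2 h₀.2
  let T₀ : X ≃L[ℂ] Y × F := ContinuousLinearEquiv.ofBijective (L₀.prod B₀) hinj hsur
  let S : Y × F →L[ℂ] X := T₀.symm
  have hTS : ∀ w, (L₀ (S w), B₀ (S w)) = w := fun w => T₀.apply_symm_apply w
  have hST : ∀ x, S (L₀ x, B₀ x) = x := fun x => T₀.symm_apply_apply x
  let D : ι → Y × F →L[ℂ] F := fun i => (B i - B₀).comp S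
  let H : ι → Y × F →L[ℂ] Y := fun i => (L i - L₀).comp S
  let inl := ContinuousLinearMap.inl ℂ Y F
  let inr := ContinuousLinearMap.inr ℂ Y F
  -- `(L i, B i) ∘ S` is the identity plus `(H i, D i)`. Here `H i` and the restriction of `D i` to
  -- `F` tend to zero in norm, but the restriction of `D i` to `Y` is merely bounded. The triangular
  -- factor `U i` cancels that block, leaving in `M i - 1` only small operators composed with the
  -- bounded `U i`.
  let U : ι → Y × F →L[ℂ] Y × F := fun i =>
    ContinuousLinearMap.id ℂ (Y × F) -
      inr.comp ((D i).comp (inl.comp (ContinuousLinearMap.fst ℂ Y F)))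
  have hU : ∀ i w, U i w = (w.1, w.2 - D i (w.1, 0)) := fun i w => by
    ext <;> simp [U, inl, inr]
  let M : ι → Y × F →L[ℂ] Y × F := fun i => ((L i).prod (B i)).comp (S.comp (U i))
  have hM : ∀ i, M i - 1 =
      ((H i).comp (U i)).prod (((D i).comp inr).comp
        ((ContinuousLinearMap.snd ℂ Y F).comp (U i))) := by
    refine fun i => ContinuousLinearMap.ext fun w => ?_
    have h1 := hTS (U i w)
    have h2 : L₀ (S (U i w)) = w.1 := by
      rw [hU] at h1 ⊢
      exact congrArg Prod.fst h1
    have h3 : B₀ (S (U i w)) = w.2 - D i (w.1, 0) := by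
      rw [hU] at h1 ⊢
      exact congrArg Prod.snd h1
    have h4 : D i (U i w) = D i (w.1, 0) + D i (0, (U i w).2) := by
      rw [← map_add, hU]
      simp
    have h5 : D i (U i w) = B i (S (U i w)) - B₀ (S (U i w)) := rfl
    refine Prod.ext ?_ ?_
    · change L i (S (U i w)) - w.1 = L i (S (U i w)) - L₀ (S (U i w))
      rw [h2]
    · change B i (S (U i w)) - w.2 = D i (0, (U i w).2)
      rw [eq_sub_of_add_eq' h4.symm, h5, h3]
      abel
  obtain ⟨C, hC⟩ := eventually_norm_le_of_tendsto_apply hB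
  have hDC : ∀ᶠ i in l, ‖U i‖ ≤ 1 + (C + ‖B₀‖) * ‖S‖ := by
    filter_upwards [hC] with i hi
    have hC0 : 0 ≤ C := (norm_nonneg _).trans hi
    have hD : ‖D i‖ ≤ (C + ‖B₀‖) * ‖S‖ := by
      refine (ContinuousLinearMap.opNorm_comp_le _ _).trans ?_
      gcongr
      exact (norm_sub_le _ _).trans (by gcongr)
    refine (U i).opNorm_le_bound (by positivity) fun w => ?_
    rw [hU]
    have h1 : ‖D i (w.1, 0)‖ ≤ (C + ‖B₀‖) * ‖S‖ * ‖w‖ := by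
      refine ((D i).le_of_opNorm_le hD _).trans ?_
      gcongr
      simp [Prod.norm_def]
    have h2 : 0 ≤ (C + ‖B₀‖) * ‖S‖ * ‖w‖ := by positivity
    rw [add_mul, one_mul]
    refine max_le ?_ ?_
    · have := norm_fst_le w
      dsimp only
      linarith
    · have h3 := norm_snd_le w
      have h4 := norm_sub_le w.2 (D i (w.1, 0))
      dsimp only
      linarith
  set R := 1 + (C + ‖B₀‖) * ‖S‖
  have hH : Tendsto (fun i => ‖H i‖ * R) l (𝓝 0) := by
    have h1 : Tendsto (fun i => ‖L i - L₀‖ * ‖S‖ * R) l (𝓝 0) := by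
      simpa using (hL.mul_const ‖S‖).mul_const R
    by_cases hR : 0 ≤ R
    · refine squeeze_zero (fun i => by positivity) (fun i => ?_) h1
      gcongr
      exact ContinuousLinearMap.opNorm_comp_le _ _
    -- A negative `R` contradicts the eventual bound `‖U i‖ ≤ R`, so here the filter is trivial.
    · refine tendsto_const_nhds.congr' ?_
      filter_upwards [hDC] with i hi
      exact absurd ((norm_nonneg _).trans hi) hR
  have hD : Tendsto (fun i => ‖(D i).comp inr‖ * R) l (𝓝 0) := by
    have h1 := tendsto_norm_zero_of_tendsto_apply (G := fun i => (D i).comp inr) (l := l) fun c => by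
      have := (hB (S (inr c))).sub_const (B₀ (S (inr c)))
      simpa [D] using this
    simpa using h1.mul_const R
  have hL1 : ∀ᶠ i in l, ‖L i - L₀‖ < 1 := hL.eventually (gt_mem_nhds one_pos)
  have hH2 : ∀ᶠ i in l, ‖H i‖ * R < 1 / 2 := hH.eventually (gt_mem_nhds (by norm_num))
  have hD2 : ∀ᶠ i in l, ‖(D i).comp inr‖ * R < 1 / 2 := hD.eventually (gt_mem_nhds (by norm_num))
  -- The entry `1` ensures positivity, the second bounds the operators, and the third bounds their
  -- inverses `S ∘ U i ∘ (M i)⁻¹`.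
  refine ⟨max 1 (max (‖L₀‖ + 1 + C) (2 * ‖S‖ * R)), by positivity, ?_⟩
  filter_upwards [hC, hDC, hL1, hH2, hD2] with i hCi hUi hLi hHi hDi
  have hR : 0 ≤ R := (norm_nonneg _).trans hUi
  have hM1 : ‖M i - 1‖ ≤ 1 / 2 := by
    rw [hM]
    refine ContinuousLinearMap.opNorm_le_bound _ (by norm_num) fun w => ?_
    have hUw := (U i).le_of_opNorm_le hUi w
    refine max_le ?_ ?_
    · change ‖H i (U i w)‖ ≤ _
      calc ‖H i (U i w)‖ ≤ ‖H i‖ * (R * ‖w‖) := (H i).le_opNorm_of_le hUw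
        _ = ‖H i‖ * R * ‖w‖ := by ring
        _ ≤ 1 / 2 * ‖w‖ := by gcongr
    · change ‖(D i).comp inr (U i w).2‖ ≤ _
      calc ‖(D i).comp inr (U i w).2‖ ≤ ‖(D i).comp inr‖ * (R * ‖w‖) :=
            ContinuousLinearMap.le_opNorm_of_le _ ((norm_snd_le _).trans hUw)
        _ = ‖(D i).comp inr‖ * R * ‖w‖ := by ring
        _ ≤ 1 / 2 * ‖w‖ := by gcongr
  have hMlow : ∀ w, ‖w‖ ≤ 2 * ‖M i w‖ := fun w => by
    have h1 := (M i - 1).le_of_opNorm_le hM1 w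
    have h2 : w = M i w - (M i - 1) w := by simp
    have h3 := norm_sub_le (M i w) ((M i - 1) w)
    rw [← h2] at h3
    linarith
  have hlow : ∀ x, ‖x‖ ≤ 2 * ‖S‖ * R * (‖L i x‖ + ‖B i x‖) := fun x => by
    -- The preimage of `(L₀ x, B₀ x)` under the triangular `U i`, obtained by reversing the sign of
    -- its off-diagonal block.
    let w : Y × F := (L₀ x, B₀ x + D i (L₀ x, 0))
    have hx : S (U i w) = x := by
      rw [hU]
      simp only [w, add_sub_cancel_right]
      exact hST x
    have h1 : M i w = (L i x, B i x) := by
      change (L i (S (U i w)), B i (S (U i w))) = _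
      rw [hx]
    have h2 : ‖M i w‖ ≤ ‖L i x‖ + ‖B i x‖ := by
      rw [h1]
      exact max_le (le_add_of_nonneg_right (norm_nonneg _)) (le_add_of_nonneg_left (norm_nonneg _))
    calc ‖x‖ = ‖S (U i w)‖ := by rw [hx]
      _ ≤ ‖S‖ * (R * ‖w‖) := S.le_opNorm_of_le ((U i).le_of_opNorm_le hUi w)
      _ ≤ ‖S‖ * (R * (2 * (‖L i x‖ + ‖B i x‖))) := by
        gcongr
        exact (hMlow w).trans (by gcongr)
      _ = _ := by ring
  refine ⟨⟨?_, ?_⟩, fun x => ⟨?_, ?_⟩⟩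
  · intro x y hxy
    have hxy' := Prod.mk.inj hxy
    have h1 := hlow (x - y)
    rw [map_sub, map_sub, hxy'.1, hxy'.2, sub_self, sub_self] at h1
    simpa [sub_eq_zero] using h1
  -- Neumann series: `M i` lies within `1 / 2` of the identity.
  · have hunit : IsUnit (M i) := by
      have := (Units.oneSub (1 - M i) (by rw [norm_sub_rev]; linarith)).isUnit
      simpa using this
    intro w
    obtain ⟨w', hw'⟩ := (ContinuousLinearMap.isUnit_iff_bijective.1 hunit).2 w
    exact ⟨S (U i w'), hw'⟩
  · have h1 : ‖L i x‖ ≤ (‖L₀‖ + 1) * ‖x‖ := by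
      refine (L i).le_of_opNorm_le ?_ x
      have := norm_le_norm_add_norm_sub' (L i) L₀
      linarith
    have h2 := (B i).le_of_opNorm_le hCi x
    calc ‖L i x‖ + ‖B i x‖ ≤ (‖L₀‖ + 1 + C) * ‖x‖ := by linarith
      _ ≤ _ := by
        gcongr
        exact (le_max_left _ _).trans (le_max_right _ _)
  · refine (hlow x).trans ?_
    gcongr
    exact (le_max_right _ _).trans (le_max_right _ _)

end

/-! ### The differential operator and its dependence on the coefficients. -/

section

variable {a b : ℝ} {hab : a < b} {m n r : ℕ} {α : ℝ}

/-- The differential operator `diffOp` as a bounded operator. -/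
noncomputable def diffOpCLM (hα : α ≤ 1) (A : Fin r → HolderMat hab m n α) :
    HolderVec hab m (n + r) α →L[ℂ] HolderVec hab m n α :=
  ((PiLp.continuousLinearEquiv 1 ℂ fun _ : Fin m => HolderSpace hab n α).symm :
      (Fin m → HolderSpace hab n α) →L[ℂ] HolderVec hab m n α).comp
    (ContinuousLinearMap.pi fun i =>
      (HolderSpace.derivCLM hα r le_rfl).comp (PiLp.proj 1 _ i) +
        ∑ j : Fin r, ∑ k : Fin m, (HolderSpace.mulCLM hα (A j i k)).comp
          ((HolderSpace.derivCLM hα (j : ℕ) j.2.le).comp (PiLp.proj 1 _ k)))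

theorem diffOpCLM_apply_apply (hα : α ≤ 1) (A : Fin r → HolderMat hab m n α)
    (y : HolderVec hab m (n + r) α) (i : Fin m) :
    diffOpCLM hα A y i = HolderSpace.derivCLM hα r le_rfl (y i) +
      ∑ j : Fin r, ∑ k : Fin m, HolderSpace.mulCLM hα (A j i k)
        (HolderSpace.derivCLM hα (j : ℕ) j.2.le (y k)) := by
  simp [diffOpCLM]

theorem diffOpCLM_apply (hα : α ≤ 1) (A : Fin r → HolderMat hab m n α)
    (y : HolderVec hab m (n + r) α) : diffOpCLM hα A y = diffOp hα A y := by
  refine PiLp.ext fun i => HolderSpace.ext fun t => ?_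
  rw [diffOpCLM_apply_apply, HolderSpace.toFun_add, HolderSpace.toFun_sum]
  simp only [HolderSpace.toFun_sum]
  rfl

/-- The leading derivatives cancel, and what remains is linear in the coefficient differences. -/
theorem norm_diffOpCLM_sub_le (hα : α ≤ 1) (A A' : Fin r → HolderMat hab m n α) :
    ‖diffOpCLM hα A - diffOpCLM hα A'‖ ≤
      ‖(HolderSpace.mulCLM hα : HolderSpace hab n α →L[ℂ] _)‖ *
        ∑ j : Fin r, ‖(HolderSpace.derivCLM hα (j : ℕ) j.2.le :
          HolderSpace hab (n + r) α →L[ℂ] HolderSpace hab n α)‖ * holderMatNorm (A j - A' j) := by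
  have h0 : ∀ j, 0 ≤ holderMatNorm (A j - A' j) := fun j =>
    Finset.sum_nonneg fun _ _ => Finset.sum_nonneg fun _ _ => norm_nonneg _
  refine ContinuousLinearMap.opNorm_le_bound _ (mul_nonneg (ContinuousLinearMap.opNorm_nonneg _)
    (Finset.sum_nonneg fun j _ => mul_nonneg (ContinuousLinearMap.opNorm_nonneg _) (h0 j))) fun y => ?_
  have h1 : ∀ i, (diffOpCLM hα A - diffOpCLM hα A') y i =
      ∑ j : Fin r, ∑ k : Fin m, HolderSpace.mulCLM hα ((A j - A' j) i k)
        (HolderSpace.derivCLM hα (j : ℕ) j.2.le (y k)) := fun i => by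
    change diffOpCLM hα A y i - diffOpCLM hα A' y i = _
    rw [diffOpCLM_apply_apply, diffOpCLM_apply_apply, add_sub_add_left_eq_sub]
    simp [← Finset.sum_sub_distrib]
  have h2 : ∀ (i k : Fin m) (j : Fin r), ‖HolderSpace.mulCLM hα ((A j - A' j) i k)
      (HolderSpace.derivCLM hα (j : ℕ) j.2.le (y k) : HolderSpace hab n α)‖ ≤
      ‖(HolderSpace.mulCLM hα : HolderSpace hab n α →L[ℂ] _)‖ *
        (‖(HolderSpace.derivCLM hα (j : ℕ) j.2.le :
          HolderSpace hab (n + r) α →L[ℂ] HolderSpace hab n α)‖ * ‖(A j - A' j) i k‖) * ‖y‖ := by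
    intro i k j
    refine ((HolderSpace.mulCLM hα).le_opNorm₂ _ _).trans ?_
    have h3 := (HolderSpace.derivCLM hα (j : ℕ) j.2.le :
      HolderSpace hab (n + r) α →L[ℂ] HolderSpace hab n α).le_opNorm_of_le (PiLp.norm_apply_le y k)
    refine (mul_le_mul_of_nonneg_left h3 (by positivity)).trans (le_of_eq ?_)
    ring
  rw [PiLp.norm_eq_of_L1]
  calc ∑ i, ‖(diffOpCLM hα A - diffOpCLM hα A') y i‖
      ≤ ∑ i : Fin m, ∑ j : Fin r, ∑ k : Fin m,
        ‖(HolderSpace.mulCLM hα : HolderSpace hab n α →L[ℂ] _)‖ *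
        (‖(HolderSpace.derivCLM hα (j : ℕ) j.2.le :
          HolderSpace hab (n + r) α →L[ℂ] HolderSpace hab n α)‖ * ‖(A j - A' j) i k‖) * ‖y‖ := by
        refine Finset.sum_le_sum fun i _ => ?_
        rw [h1]
        refine (norm_sum_le _ _).trans (Finset.sum_le_sum fun j _ => ?_)
        exact (norm_sum_le _ _).trans (Finset.sum_le_sum fun k _ => h2 i k j)
    _ = _ := by
        rw [Finset.sum_comm]
        simp only [holderMatNorm, Finset.mul_sum, Finset.sum_mul]

theorem tendsto_diffOpCLM {ι : Type*} {l : Filter ι} (hα : α ≤ 1)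
    {A : ι → Fin r → HolderMat hab m n α} {A₀ : Fin r → HolderMat hab m n α}
    (hA : ∀ j, Tendsto (fun i => holderMatNorm (A i j - A₀ j)) l (𝓝 0)) :
    Tendsto (fun i => ‖diffOpCLM hα (A i) - diffOpCLM hα A₀‖) l (𝓝 0) := by
  refine squeeze_zero (fun _ => norm_nonneg _) (fun i => norm_diffOpCLM_sub_le hα (A i) A₀) ?_
  have h1 := (tendsto_finsetSum (Finset.univ : Finset (Fin r)) fun j _ =>
    (hA j).const_mul ‖(HolderSpace.derivCLM hα (j : ℕ) j.2.le :
      HolderSpace hab (n + r) α →L[ℂ] HolderSpace hab n α)‖).const_mul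
        ‖(HolderSpace.mulCLM hα : HolderSpace hab n α →L[ℂ] _)‖
  simpa using h1

/-! ### Initial value problems in the Hölder scale. -/

/-- The first-order system equivalent to `L y = f`. -/
noncomputable def companionField (A : Fin r → HolderMat hab m n α) (f : HolderVec hab m n α)
    (t : ℝ) (z : Fin r → Fin m → ℂ) : Fin r → Fin m → ℂ := fun j k =>
  if h : (j : ℕ) + 1 < r then z ⟨j + 1, h⟩ k else
    IccExtend hab.le (f k).toFun t - ∑ j', ∑ k', IccExtend hab.le (A j' k k').toFun t * z j' k'

theorem continuous_companionField (A : Fin r → HolderMat hab m n α) (f : HolderVec hab m n α) :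
    Continuous (Function.uncurry (companionField A f)) := by
  have hA : ∀ j i k, Continuous (IccExtend hab.le (A j i k).toFun) := fun j i k =>
    (A j i k).continuous_toFun.Icc_extend'
  have hf : ∀ k, Continuous (IccExtend hab.le (f k).toFun) := fun k =>
    (f k).continuous_toFun.Icc_extend'
  refine continuous_pi fun j => continuous_pi fun k => ?_
  simp only [Function.uncurry_def, companionField]
  split_ifs <;> fun_prop

theorem exists_lipschitzWith_companionField (A : Fin r → HolderMat hab m n α)
    (f : HolderVec hab m n α) : ∃ K : NNReal, ∀ t, LipschitzWith K (companionField A f t) := by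
  -- The summand `1` serves the rows that merely shift components; the sum serves the last row.
  refine ⟨1 + ∑ i, ∑ j, ∑ k, ‖A j i k‖₊, fun t => lipschitzWith_iff_norm_sub_le.2 fun z w => ?_⟩
  push_cast
  refine (pi_norm_le_iff_of_nonneg (by positivity)).2 fun j =>
    (pi_norm_le_iff_of_nonneg (by positivity)).2 fun k => ?_
  have hzw : ∀ j k, ‖z j k - w j k‖ ≤ ‖z - w‖ := fun j k =>
    (norm_le_pi_norm ((z - w) j) k).trans (norm_le_pi_norm (z - w) j)
  simp only [Pi.sub_apply, companionField]
  have h0 : 0 ≤ ∑ i, ∑ j, ∑ k, ‖A j i k‖ := by positivity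
  split_ifs with h
  · refine (hzw _ _).trans (le_mul_of_one_le_left (norm_nonneg _) ?_)
    exact le_add_of_nonneg_right h0
  · rw [sub_sub_sub_cancel_left, norm_sub_rev]
    simp only [← Finset.sum_sub_distrib, ← mul_sub]
    have h1 : ∑ j, ∑ k', ‖A j k k'‖ ≤ 1 + ∑ i, ∑ j, ∑ k, ‖A j i k‖ := by
      have := Finset.single_le_sum (f := fun i => ∑ j, ∑ k, ‖A j i k‖)
        (fun i _ => by positivity) (Finset.mem_univ k)
      linarith
    refine le_trans ?_ (mul_le_mul_of_nonneg_right h1 (norm_nonneg _))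
    simp only [Finset.sum_mul]
    refine (norm_sum_le _ _).trans (Finset.sum_le_sum fun j' _ => ?_)
    refine (norm_sum_le _ _).trans (Finset.sum_le_sum fun k' _ => ?_)
    rw [norm_mul]
    exact mul_le_mul (HolderSpace.norm_toFun_le _ _) (hzw _ _) (norm_nonneg _) (norm_nonneg _)

/-- The initial value problem for the equation `L y = f` is solvable in `(C^{n+r,α})^m`. -/
theorem exists_diffOp_eq (hα : α ≤ 1) (A : Fin r → HolderMat hab m n α)
    (f : HolderVec hab m n α) (c : Fin r → Fin m → ℂ) :
    ∃ y : HolderVec hab m (n + r) α, diffOp hα A y = f ∧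
      ∀ (j : Fin r) k, iccDeriv hab (j : ℕ) (y k).toFun ⟨a, left_mem_Icc.2 hab.le⟩ = c j k := by
  obtain ⟨K, hK⟩ := exists_lipschitzWith_companionField A f
  obtain ⟨z, hza, hz⟩ := exists_hasDerivWithinAt_of_lipschitzWith hab.le
    (continuous_companionField A f) hK c
  -- The chain of derivatives of the `k`-th unknown: components of the system below `r`, and the
  -- value prescribed by the equation at index `r`.
  let w : Fin m → ℕ → Icc a b → ℂ := fun k j t =>
    if h : j < r then z t ⟨j, h⟩ k else
      (f k).toFun t - ∑ j', ∑ k', (A j' k k').toFun t * z t j' k'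
  have hw : ∀ k (j : Fin r) t, w k j t = z t j k := fun k j t => dif_pos j.2
  have hwr : ∀ k t, w k r t =
      (f k).toFun t - ∑ j' : Fin r, ∑ k', (A j' k k').toFun t * w k' j' t := fun k t => by
    simp only [hw]
    exact dif_neg (lt_irrefl r)
  have hd : ∀ k, ∀ j < r, ∀ t : Icc a b,
      HasDerivWithinAt (IccExtend hab.le (w k j)) (w k (j + 1) t) (Icc a b) t := by
    intro k j hj t
    have h1 := hasDerivWithinAt_pi.1 (hasDerivWithinAt_pi.1 (hz t t.2) ⟨j, hj⟩) k
    have h2 : companionField A f t (z t) ⟨j, hj⟩ k = w k (j + 1) t := by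
      simp only [companionField, w, iccExtend_coe (hab := hab)]
    rw [h2] at h1
    exact h1.congr_of_mem (fun s hs => by rw [IccExtend_of_mem hab.le _ hs]; exact dif_pos hj) t.2
  have hzc : Continuous fun t : Icc a b => z t :=
    continuousOn_iff_continuous_domRestrict.1 fun t ht => (hz t ht).continuousWithinAt
  have hwc : ∀ k j, Continuous (w k j) := fun k j => by
    have hA : ∀ j i k, Continuous (A j i k).toFun := fun j i k => (A j i k).continuous_toFun
    have hf : ∀ k, Continuous (f k).toFun := fun k => (f k).continuous_toFun
    have hzc' : ∀ j k, Continuous fun t : Icc a b => z t j k := fun j k =>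
      (continuous_apply k).comp ((continuous_apply j).comp hzc)
    by_cases h : j < r
    · simpa only [w, dif_pos h] using hzc' _ k
    · simp only [w, dif_neg h]
      exact (hf k).sub (continuous_finsetSum _ fun j' _ => continuous_finsetSum _ fun k' _ =>
        (hA j' k k').mul (hzc' j' k'))
  -- The equation expresses the top derivative through products of coefficients and lower
  -- derivatives, so it inherits their regularity up to order `n`.
  have hclosed : ∀ p ≤ n, (∀ k (j : Fin r), IsHolder hab p α (w k j)) →
      ∀ k, IsHolder hab p α (w k r) := by
    intro p hp h k
    have hdown : ∀ x : HolderSpace hab n α, IsHolder hab p α x.toFun := fun x =>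
      IsHolder.of_add hα (n - p) (by rw [Nat.add_sub_cancel' hp]; exact x.isHolder)
    have h1 : w k r = (f k).toFun +
        (-1 : ℂ) • ∑ j' : Fin r, ∑ k', (A j' k k').toFun * w k' j' := by
      funext t
      simp [hwr, Finset.sum_apply, sub_eq_add_neg]
    rw [h1]
    exact (hdown _).add ((IsHolder.sum _ fun j' => IsHolder.sum _ fun k' =>
      (hdown _).mul hα (h k' j')).smul (-1))
  -- Bootstrap: top derivatives in `C^{p,α}` place all lower ones in `C^{p+1,α}`, and `hclosed`
  -- returns the gain to the top. To start, the lower derivatives have continuous, hence bounded,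
  -- derivatives.
  have hreg : ∀ p ≤ n, ∀ k, IsHolder hab p α (w k r) := by
    intro p
    induction p with
    | zero =>
      refine fun hp => hclosed 0 hp fun k j => ?_
      obtain ⟨C, hC⟩ := bddAbove_norm_of_continuous (hwc k (j + 1))
      exact isHolder_zero_of_hasDerivWithinAt hα (hd k j j.2) hC
    | succ p ih =>
      refine fun hp => hclosed (p + 1) hp fun k j => ?_
      have h1 := isHolder_of_hasDerivWithinAt (i := r - j) (j := j) (hd k)
        (ih (by omega) k) (by omega)
      refine IsHolder.of_add hα (r - j - 1) ?_
      rwa [show p + 1 + (r - j - 1) = p + (r - j) by omega]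
  have hder : ∀ k, ∀ j ≤ r, iccDeriv hab j (w k 0) = w k j := fun k =>
    iccDeriv_eq_of_hasDerivWithinAt (hd k)
  refine ⟨WithLp.toLp 1 fun k => HolderSpace.mk (w k 0)
    (isHolder_of_hasDerivWithinAt (hd k) (hreg n le_rfl k) (zero_add r)), ?_, fun j k => ?_⟩
  · refine PiLp.ext fun i => HolderSpace.ext fun t => ?_
    change iccDeriv hab r (w i 0) t +
      ∑ j : Fin r, ∑ k : Fin m, (A j i k).toFun t * iccDeriv hab (j : ℕ) (w k 0) t = _
    simp only [hder _ _ le_rfl, hder _ _ (Fin.is_lt _).le, hwr]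
    ring
  · change iccDeriv hab j (w k 0) _ = _
    rw [hder k j j.2.le, hw]
    exact congrFun (congrFun hza j) k

/-! ### Unique solvability from triviality of the homogeneous problem. -/

/-- If the homogeneous boundary-value problem has only the trivial solution, the inhomogeneous
problem is uniquely solvable. -/
theorem bijective_diffOpCLM_of_injective (hα : α ≤ 1) (A : Fin r → HolderMat hab m n α)
    (B : HolderVec hab m (n + r) α →L[ℂ] EuclideanSpace ℂ (Fin (r * m)))
    (h0 : ∀ y, diffOp hα A y = 0 → B y = 0 → y = 0) :
    Function.Bijective fun y => (diffOpCLM hα A y, B y) := by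
  let N := (diffOpCLM hα A).ker
  let init : N →ₗ[ℂ] (Fin r → Fin m → ℂ) :=
    (LinearMap.pi fun j : Fin r => LinearMap.pi fun k =>
      ((HolderSpace.derivAt (j : ℕ) (by omega) ⟨a, left_mem_Icc.2 hab.le⟩).comp
        (PiLp.proj 1 (fun _ : Fin m => HolderSpace hab (n + r) α) k)).toLinearMap).comp N.subtype
  let BN : N →ₗ[ℂ] EuclideanSpace ℂ (Fin (r * m)) := B.toLinearMap.comp N.subtype
  have hN : ∀ y : N, diffOp hα A y = 0 := fun y => by
    rw [← diffOpCLM_apply]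
    exact y.2
  have hinit : Function.Surjective init := fun c => by
    obtain ⟨y, hy, hyc⟩ := exists_diffOp_eq hα A 0 c
    exact ⟨⟨y, by rw [← diffOpCLM_apply] at hy; exact hy⟩, funext fun j => funext fun k => hyc j k⟩
  have hBN : Function.Injective BN :=
    (injective_iff_map_eq_zero BN).2 fun y hy => Subtype.ext (h0 y (hN y) hy)
  have : FiniteDimensional ℂ N := FiniteDimensional.of_injective BN hBN
  -- `BN` bounds the dimension of the kernel above by `r * m`, and the surjection `init` onto
  -- initial data bounds it below; uniqueness for the initial value problem is not needed.
  have hdim : Module.finrank ℂ N = Module.finrank ℂ (EuclideanSpace ℂ (Fin (r * m))) := by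
    refine le_antisymm (LinearMap.finrank_le_finrank_of_injective hBN) ?_
    have h1 := LinearMap.finrank_le_finrank_of_surjective hinit
    simpa [Module.finrank_pi_fintype] using h1
  have hBsur := (LinearMap.injective_iff_surjective_of_finrank_eq_finrank hdim).1 hBN
  constructor
  · intro y y' h
    have h' := Prod.mk.inj h
    refine sub_eq_zero.1 (h0 _ ?_ ?_)
    · rw [← diffOpCLM_apply, map_sub, h'.1, sub_self]
    · rw [map_sub, h'.2, sub_self]
  · rintro ⟨f, c⟩
    obtain ⟨y₁, hy₁, -⟩ := exists_diffOp_eq hα A f 0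
    -- A kernel element repairs the boundary data of the particular solution `y₁`.
    obtain ⟨y₂, hy₂⟩ := hBsur (c - B y₁)
    refine ⟨y₁ + y₂, Prod.ext ?_ ?_⟩
    · change diffOpCLM hα A (y₁ + y₂) = f
      rw [map_add, diffOpCLM_apply, diffOpCLM_apply, hy₁, hN, add_zero]
    · change B (y₁ + y₂) = c
      rw [map_add, show B y₂ = c - B y₁ from hy₂]
      abel

end

/-! ### The main theorem. -/

theorem theorem1 {a b : ℝ} (hab : a < b) (m r n : ℕ) (hm : 1 ≤ m) (hr : 2 ≤ r)
    (α : ℝ) (hα₀ : 0 < α) (hα₁ : α ≤ 1) (ε₀ : ℝ) (hε₀ : 0 < ε₀)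
    (A : ℝ → Fin r → HolderMat hab m n α)
    (B : ℝ → HolderVec hab m (n + r) α →L[ℂ] EuclideanSpace ℂ (Fin (r * m)))
    (h0 : ∀ y : HolderVec hab m (n + r) α, diffOp hα₁ (A 0) y = 0 → B 0 y = 0 → y = 0)
    (hI : ∀ j : Fin r, Tendsto (fun ε => holderMatNorm (A ε j - A 0 j)) (𝓝[>] 0) (𝓝 0))
    (hII : ∀ y : HolderVec hab m (n + r) α,
      Tendsto (fun ε => B ε y) (𝓝[>] 0) (𝓝 (B 0 y))) :
    (∃ ε₁, 0 < ε₁ ∧ ε₁ < ε₀ ∧ UniquelySolvable hα₁ A B ε₁) ∧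
    ∀ ε₁, 0 < ε₁ → ε₁ < ε₀ → UniquelySolvable hα₁ A B ε₁ →
      ∃ ε₂ κ₁ κ₂ : ℝ, 0 < ε₂ ∧ ε₂ < ε₁ ∧ 0 < κ₁ ∧ 0 < κ₂ ∧
        ∀ (f : ℝ → HolderVec hab m n α) (c : ℝ → EuclideanSpace ℂ (Fin (r * m)))
          (y : ℝ → HolderVec hab m (n + r) α),
          (∀ ε ∈ Ico 0 ε₁, diffOp hα₁ (A ε) (y ε) = f ε ∧ B ε (y ε) = c ε) →
          ∀ ε ∈ Ioo 0 ε₂,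
            κ₁ * discrepancy hα₁ (A ε) (B ε) (f ε) (c ε) (y 0) ≤ ‖y 0 - y ε‖ ∧
            ‖y 0 - y ε‖ ≤ κ₂ * discrepancy hα₁ (A ε) (B ε) (f ε) (c ε) (y 0) := by
  have hbij := bijective_diffOpCLM_of_injective hα₁ (A 0) (B 0) h0
  obtain ⟨κ, hκ, hev⟩ := eventually_bijective_and_norm_le (tendsto_diffOpCLM hα₁ hI) hII hbij
  obtain ⟨δ, hδ, hev⟩ := (mem_nhdsGT_iff_exists_Ioo_subset).1 hev
  have hδ : 0 < δ := hδ
  constructor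
  · refine ⟨min δ (ε₀ / 2), by positivity, (min_le_right _ _).trans_lt (half_lt_self hε₀), ?_⟩
    intro ε hε f c
    have hb : Function.Bijective fun y => (diffOpCLM hα₁ (A ε) y, B ε y) := by
      -- The limit conditions concern only `ε > 0`, so `ε = 0` is supplied by `hbij`.
      rcases hε.1.eq_or_lt with rfl | hpos
      · exact hbij
      · exact (hev ⟨hpos, hε.2.trans_le (min_le_left _ _)⟩).1
    simpa only [Prod.mk.injEq, diffOpCLM_apply] using hb.existsUnique (f, c)
  · intro ε₁ hε₁ _ _
    refine ⟨min δ (ε₁ / 2), κ⁻¹, κ, by positivity,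
      (min_le_right _ _).trans_lt (half_lt_self hε₁), by positivity, hκ, ?_⟩
    intro f c y hy ε hε
    have hε' : ε < ε₁ := hε.2.trans ((min_le_right _ _).trans_lt (half_lt_self hε₁))
    obtain ⟨hL, hB⟩ := hy ε ⟨hε.1.le, hε'⟩
    obtain ⟨h1, h2⟩ := (hev ⟨hε.1, hε.2.trans_le (min_le_left _ _)⟩).2 (y 0 - y ε)
    -- Since `y ε` solves the problem at `ε`, linearity makes the discrepancy of `y 0` the size of
    -- the image of the error, and `κ` bounds the ratio both ways.
    have hdisc : ‖diffOpCLM hα₁ (A ε) (y 0 - y ε)‖ + ‖B ε (y 0 - y ε)‖ =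
        discrepancy hα₁ (A ε) (B ε) (f ε) (c ε) (y 0) := by
      rw [map_sub, map_sub, diffOpCLM_apply, diffOpCLM_apply, hL, hB, discrepancy]
    rw [hdisc] at h1 h2
    exact ⟨(inv_mul_le_iff₀ hκ).2 h1, h2⟩
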